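/- Let $p:E\to M$ be a locally trivial smooth fiber bundle (finite-dimensional smooth manifolds without boundary, non-empty standard fiber), let $\omega$ be a symplectic form on $E$, and let $\Theta\in\Omega^1(E)$ be a Liouville form, that is: $\Theta$ is horizontal ($\Theta(Y)=0$ for every $Y\in VE=\ker Tp$), $\omega=d\Theta$, and the fibers of $p$ are Lagrangian submanifolds of $(E,\omega)$. For a smooth vector field $X\in\mathfrak X(M)$ let $\Theta(X\circ p)\in C^\infty(E,\mathbb R)$ be the function $u\mapsto\Theta_u(\xi)$, where $\xi\in T_uE$ is any vector with $T_up\,\xi=X(p(u))$. A smooth vector field $X^\Theta\in\mathfrak X(E)$ is called a Liouville lift of $X$ if $Tp\circ X^\Theta=X\circ p$ and $\mathcal L_{X^\Theta}\Theta=0$. For $f\in C^\infty(E,\mathbb R)$ let $H_f$ be the Hamiltonian vector field given by $i_{H_f}\omega=df$, and let $\{f,g\}=dg(H_f)$ be the Poisson bracket (so that $\{q^i,p_i\}=1$ if $\omega=\sum_i dp_i\wedge dq^i$). Then: 1. If $X^\Theta$ is a Liouville lift of $X\in\mathfrak X(M)$, then $i_{X^\Theta}\omega=-d(\Theta(X\circ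 p))$, that is, $X^\Theta=H_{-\Theta(X\circ p)}$. Conversely, for every $X\in\mathfrak X(M)$ the vector field $H_{-\Theta(X\circ p)}$ is smooth, projectable onto $X$, and preserves $\Theta$. Thus every $X$ has exactly one Liouville lift. 2. The Poisson bracket makes $C^\infty(E,\mathbb R)$ a real Lie algebra, and the map $\mathfrak X(M)\to C^\infty(E,\mathbb R)$, $X\mapsto-\Theta(X\circ p)$, is an injective homomorphism of Lie algebras: it is $\mathbb R$-linear and injective, and $-\Theta([X,Y]\circ p)=\{-\Theta(X\circ p),-\Theta(Y\circ p)\}$ for all $X,Y\in\mathfrak X(M)$. -/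

import Mathlib

open scoped Manifold ContDiff Bundle

noncomputable section

namespace LiouvilleLift

/-! Throughout, `V`, `B` and `W` are finite-dimensional real vector spaces, and manifolds are smooth
manifolds without boundary, modelled on them through `𝓘(ℝ, V)`, `𝓘(ℝ, B)` and `𝓘(ℝ, W)`. -/

section Forms

variable {V : Type*} [NormedAddCommGroup V] [NormedSpace ℝ V]
  {E : Type*} [TopologicalSpace E] [ChartedSpace V E]

variable (V) in
/-- Vector fields on `E`, not necessarily smooth. -/
abbrev VField (E : Type*) [TopologicalSpace E] [ChartedSpace V E] : Type _ :=
  Π u : E, TangentSpace 𝓘(ℝ, V) u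

variable (V) in
/-- Differential `k`-forms on `E`, not necessarily smooth. -/
abbrev Form (E : Type*) [TopologicalSpace E] [ChartedSpace V E] (k : ℕ) : Type _ :=
  Π u : E, TangentSpace 𝓘(ℝ, V) u [⋀^Fin k]→L[ℝ] ℝ

/-- Smooth functions on `E`. -/
def IsSmoothFun (V : Type*) [NormedAddCommGroup V] [NormedSpace ℝ V]
    {E : Type*} [TopologicalSpace E] [ChartedSpace V E] (f : E → ℝ) : Prop :=
  ContMDiff 𝓘(ℝ, V) 𝓘(ℝ, ℝ) ∞ f

/-- Smoothness of a vector field at a point, as a section of the tangent bundle. -/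
def IsSmoothVFieldAt [IsManifold 𝓘(ℝ, V) ∞ E] (X : VField V E) (u : E) : Prop :=
  ContMDiffAt 𝓘(ℝ, V) 𝓘(ℝ, V).tangent ∞ (fun z => (⟨z, X z⟩ : TangentBundle 𝓘(ℝ, V) E)) u

/-- Smooth vector fields. -/
def IsSmoothVField [IsManifold 𝓘(ℝ, V) ∞ E] (X : VField V E) : Prop :=
  ∀ u, IsSmoothVFieldAt X u

/-- The expression of a form in the preferred chart `φ` around `u₀`: the pullback of `α` by `φ⁻¹`.
It is meaningful on the (open) target of `φ`. -/
def Form.inChart {k : ℕ} (α : Form V E k) (u₀ : E) (y : V) : V [⋀^Fin k]→L[ℝ] ℝ :=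
  (α ((extChartAt 𝓘(ℝ, V) u₀).symm y)).compContinuousLinearMap
    (mfderiv 𝓘(ℝ, V) 𝓘(ℝ, V) (extChartAt 𝓘(ℝ, V) u₀).symm y)

/-- Smooth differential forms: smooth in charts. -/
def Form.IsSmooth {k : ℕ} (α : Form V E k) : Prop :=
  ∀ u₀ : E, ContDiffOn ℝ ∞ (α.inChart u₀) (extChartAt 𝓘(ℝ, V) u₀).target

/-- The exterior derivative of a form on a manifold, computed in the preferred chart at each point.
No normalizing factor: `dΘ (X, Y) = X (Θ Y) - Y (Θ X) - Θ [X, Y]` for a `1`-form `Θ`. -/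
def Form.d {k : ℕ} (α : Form V E k) : Form V E (k + 1) := fun u =>
  (extDeriv (α.inChart u) (extChartAt 𝓘(ℝ, V) u u)).compContinuousLinearMap
    (mfderiv 𝓘(ℝ, V) 𝓘(ℝ, V) (extChartAt 𝓘(ℝ, V) u) u)

/-- The Lie derivative of a form, evaluated on vector fields:
`(L_X α)(Y₁, …, Yₖ) = X (α (Y₁, …, Yₖ)) - ∑ i, α (Y₁, …, [X, Yᵢ], …, Yₖ)`. -/
def lieDeriv {k : ℕ} (X : VField V E) (α : Form V E k) (Y : Fin k → VField V E) (u : E) : ℝ :=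
  mvfderiv 𝓘(ℝ, V) (fun z => α z (fun i => Y i z)) u (X u) -
    ∑ i, α u (Function.update (fun j => Y j u) i (VectorField.mlieBracket 𝓘(ℝ, V) X (Y i) u))

/-- `X` preserves the form `α`: `L_X α = 0`. As `L_X α` is a local operator, it is tested at each
point on all vector fields that are smooth near that point. -/
def Preserves [IsManifold 𝓘(ℝ, V) ∞ E] {k : ℕ} (X : VField V E) (α : Form V E k) : Prop :=
  ∀ (u : E) (Y : Fin k → VField V E), (∀ i, IsSmoothVFieldAt (Y i) u) → lieDeriv X α Y u = 0

/-- Symplectic forms: smooth closed nondegenerate `2`-forms. -/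
structure IsSymplectic (Ω : Form V E 2) : Prop where
  smooth : Ω.IsSmooth
  closed : Ω.d = 0
  nondegenerate : ∀ (u : E) (v : TangentSpace 𝓘(ℝ, V) u),
    (∀ w : TangentSpace 𝓘(ℝ, V) u, Ω u ![v, w] = 0) → v = 0

/-- The Hamiltonian vector field `H_f` of `f`, defined by `i_{H_f} Ω = df`: at `u` it is the unique
preimage of `df(u)` under the map `v ↦ Ω(v, ·)`. -/
def hamiltonian (Ω : Form V E 2) (f : E → ℝ) : VField V E := fun u =>
  Function.invFun (fun v w : TangentSpace 𝓘(ℝ, V) u => Ω u ![v, w]) (mvfderiv 𝓘(ℝ, V) f u)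

/-- For a symplectic form the Hamiltonian vector field satisfies its defining equation. -/
theorem hamiltonian_spec [FiniteDimensional ℝ V] {Ω : Form V E 2} (hΩ : IsSymplectic Ω)
    (f : E → ℝ) (u : E) (w : TangentSpace 𝓘(ℝ, V) u) :
    Ω u ![hamiltonian Ω f u, w] = mvfderiv 𝓘(ℝ, V) f u w := by
  have : FiniteDimensional ℝ (TangentSpace 𝓘(ℝ, V) u) := inferInstanceAs (FiniteDimensional ℝ V)
  let b : TangentSpace 𝓘(ℝ, V) u →ₗ[ℝ] Module.Dual ℝ (TangentSpace 𝓘(ℝ, V) u) :=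
    LinearMap.mk₂ ℝ (fun v w => Ω u ![v, w])
      (fun v v' w => (Ω u).vecCons_add _ v v')
      (fun c v w => (Ω u).vecCons_smul _ c v)
      (fun v w w' => by
        have e (x : TangentSpace 𝓘(ℝ, V) u) : ![v, x] = Function.update ![v, w] 1 x := by
          ext i; fin_cases i <;> rfl
        rw [e (w + w'), (Ω u).map_update_add, ← e, ← e])
      (fun c v w => by
        have e (x : TangentSpace 𝓘(ℝ, V) u) : ![v, x] = Function.update ![v, w] 1 x := by
          ext i; fin_cases i <;> rfl
        rw [e (c • w), (Ω u).map_update_smul, ← e])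
  have hinj : Function.Injective b := by
    rw [← LinearMap.ker_eq_bot, LinearMap.ker_eq_bot']
    intro v hv
    exact hΩ.nondegenerate u v fun w => LinearMap.congr_fun hv w
  have hsurj : Function.Surjective b :=
    (LinearMap.injective_iff_surjective_of_finrank_eq_finrank
      Subspace.dual_finrank_eq.symm).1 hinj
  obtain ⟨v, hv⟩ := hsurj (mvfderiv 𝓘(ℝ, V) f u).toLinearMap
  exact congrFun (Function.invFun_eq (f := fun v w : TangentSpace 𝓘(ℝ, V) u => Ω u ![v, w])
    (b := mvfderiv 𝓘(ℝ, V) f u) ⟨v, funext fun w => LinearMap.congr_fun hv w⟩) w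

/-- The Poisson bracket of functions, `{f, g} = dg (H_f) = Ω (H_g, H_f)`. For `Ω = ∑ dpᵢ ∧ dqⁱ` it
is `{f, g} = ∑ (∂f/∂qⁱ ∂g/∂pᵢ - ∂f/∂pᵢ ∂g/∂qⁱ)`. -/
def poisson (Ω : Form V E 2) (f g : E → ℝ) : E → ℝ := fun u =>
  mvfderiv 𝓘(ℝ, V) g u (hamiltonian Ω f u)

end Forms

section Bundle

variable {V : Type*} [NormedAddCommGroup V] [NormedSpace ℝ V]
  {E : Type*} [TopologicalSpace E] [ChartedSpace V E]
  {B : Type*} [NormedAddCommGroup B] [NormedSpace ℝ B]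
  {M : Type*} [TopologicalSpace M] [ChartedSpace B M]

/-- Locally trivial smooth fiber bundles `p : E → M` with standard fiber the manifold `F`. -/
structure IsSmoothFiberBundle (V B W F : Type*)
    [NormedAddCommGroup V] [NormedSpace ℝ V] [NormedAddCommGroup B] [NormedSpace ℝ B]
    [NormedAddCommGroup W] [NormedSpace ℝ W] [TopologicalSpace F] [ChartedSpace W F]
    {E : Type*} [TopologicalSpace E] [ChartedSpace V E]
    {M : Type*} [TopologicalSpace M] [ChartedSpace B M] (p : E → M) : Prop where
  smooth : ContMDiff 𝓘(ℝ, V) 𝓘(ℝ, B) ∞ p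
  locally_trivial : ∀ x : M, ∃ e : Bundle.Trivialization F p, x ∈ e.baseSet ∧
    ContMDiffOn 𝓘(ℝ, V) (𝓘(ℝ, B).prod 𝓘(ℝ, W)) ∞ e e.source ∧
    ContMDiffOn (𝓘(ℝ, B).prod 𝓘(ℝ, W)) 𝓘(ℝ, V) ∞ e.toOpenPartialHomeomorph.symm e.target

/-- The vertical bundle `VE = ker Tp`. -/
def vertical (V B : Type*) [NormedAddCommGroup V] [NormedSpace ℝ V]
    [NormedAddCommGroup B] [NormedSpace ℝ B]
    {E : Type*} [TopologicalSpace E] [ChartedSpace V E]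
    {M : Type*} [TopologicalSpace M] [ChartedSpace B M] (p : E → M) (u : E) :
    Submodule ℝ (TangentSpace 𝓘(ℝ, V) u) :=
  (mfderiv 𝓘(ℝ, V) 𝓘(ℝ, B) p u).ker

/-- Liouville forms `Θ` on a fiber bundle `p : E → M` with symplectic form `Ω`. The tangent spaces
of the fibers are the vertical spaces; a fiber is Lagrangian if each of its tangent spaces is equal
to its own `Ω`-orthogonal space. -/
structure IsLiouvilleForm (B : Type*) [NormedAddCommGroup B] [NormedSpace ℝ B]
    {M : Type*} [TopologicalSpace M] [ChartedSpace B M]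
    (p : E → M) (Ω : Form V E 2) (Θ : Form V E 1) : Prop where
  smooth : Θ.IsSmooth
  horizontal : ∀ u, ∀ v ∈ vertical V B p u, Θ u ![v] = 0
  d_eq : Ω = Θ.d
  lagrangian : ∀ (u : E) (v : TangentSpace 𝓘(ℝ, V) u),
    v ∈ vertical V B p u ↔ ∀ w ∈ vertical V B p u, Ω u ![v, w] = 0

/-- The function `Θ (X ∘ p)` on `E`, where the horizontal form `Θ` is evaluated on `p^*TM`, that is,
on an arbitrary preimage of `X (p u)` under `T_u p`. -/
def evalBase (p : E → M) (Θ : Form V E 1) (X : VField B M) : E → ℝ := fun u =>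
  Θ u ![Function.invFun (mfderiv 𝓘(ℝ, V) 𝓘(ℝ, B) p u) (X (p u))]

/-- The value of `Θ (X ∘ p)` does not depend on the preimage. -/
theorem evalBase_eq {p : E → M} {Ω : Form V E 2} {Θ : Form V E 1} (hΘ : IsLiouvilleForm B p Ω Θ)
    (X : VField B M) (u : E) (v : TangentSpace 𝓘(ℝ, V) u)
    (hv : mfderiv 𝓘(ℝ, V) 𝓘(ℝ, B) p u v = X (p u)) : evalBase p Θ X u = Θ u ![v] := by
  set v' : TangentSpace 𝓘(ℝ, V) u :=
    Function.invFun (mfderiv 𝓘(ℝ, V) 𝓘(ℝ, B) p u) (X (p u)) with hv'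
  have h : mfderiv 𝓘(ℝ, V) 𝓘(ℝ, B) p u v' = X (p u) := Function.invFun_eq ⟨v, hv⟩
  have h0 : v' - v ∈ vertical V B p u := by
    simp [vertical, map_sub, h, hv]
  have h1 := (Θ u).vecCons_add ![] v (v' - v)
  rw [add_sub_cancel, hΘ.horizontal u _ h0, add_zero] at h1
  exact h1

/-- The function `-Θ (X)`. -/
def momentum (p : E → M) (Θ : Form V E 1) (X : VField B M) : E → ℝ := fun u => - evalBase p Θ X u

/-- `Z` is a Liouville lift of `X`: a smooth vector field that is projectable onto `X` and
preserves `Θ`. -/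
structure IsLiouvilleLift [IsManifold 𝓘(ℝ, V) ∞ E] (p : E → M) (Θ : Form V E 1)
    (X : VField B M) (Z : VField V E) : Prop where
  smooth : IsSmoothVField Z
  projects : ∀ u, mfderiv 𝓘(ℝ, V) 𝓘(ℝ, B) p u (Z u) = X (p u)
  preserves : Preserves Z Θ

end Bundle

end LiouvilleLift

end

open scoped Manifold ContDiff Bundle
open Set Filter Topology VectorField

set_option linter.unusedSectionVars false

namespace LiouvilleLift


/-! ### Vector fields and derivatives in the preferred chart at a point. -/

section Chart

variable {V : Type*} [NormedAddCommGroup V] [NormedSpace ℝ V] [FiniteDimensional ℝ V]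
  {E : Type*} [TopologicalSpace E] [ChartedSpace V E] [IsManifold 𝓘(ℝ, V) ∞ E]
  {G : Type*} [NormedAddCommGroup G] [NormedSpace ℝ G]

/-! Everything rests on Cartan's formula. If `Z` projects onto `X`, then `Θ(Z) = Θ(X ∘ p)` is minus
the momentum of `X`, so `L_Z Θ = i_Z dΘ + d(Θ(Z)) = i_Z Ω - d(momentum)` (`lieDeriv_of_projects`).
By nondegeneracy the only possible Liouville lift is the Hamiltonian field `H` of the momentum, and
`H` does preserve `Θ` once it is known to project onto `X`.

That projection is the main point (`mfderiv_hamiltonian_momentum`). Take a local lift `Z` of `X` and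
a local vertical field `Y`. Then `Θ(Y) = 0` and `[Z, Y]` is vertical, so `(L_Z Θ)(Y) = 0`, that is,
`Ω(Z - H, Y) = 0`. Since the fibers are Lagrangian, `Z - H` is vertical.

For brackets, the lifts of `X` and `Y` have a bracket projecting onto `[X, Y]`, and invariance of
`Θ` evaluates `Θ` on it. Injectivity holds because `H` determines `X` by projection. The Jacobi
identity comes from `dΩ = 0` through `[H_f, H_g] = H_{f, g}` (`hamiltonian_poisson`).

All arguments are local: fields need only be smooth near one point, so neither cutoff functions nor
global extensions occur. -/

omit [FiniteDimensional ℝ V] in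
theorem extChartAt_target_nhds {u : E} {y : V} (hy : y ∈ (extChartAt 𝓘(ℝ, V) u).target) :
    (extChartAt 𝓘(ℝ, V) u).target ∈ 𝓝 y :=
  (isOpen_extChartAt_target u).mem_nhds hy

/-- The expression of a vector field in the preferred chart around `u`. -/
noncomputable def chartVField (u : E) (X : VField V E) (y : V) : V :=
  mpullback 𝓘(ℝ, V) 𝓘(ℝ, V) (extChartAt 𝓘(ℝ, V) u).symm X y

theorem isInvertible_mfderiv_extChartAt_symm {u : E} {y : V}
    (hy : y ∈ (extChartAt 𝓘(ℝ, V) u).target) :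
    (mfderiv 𝓘(ℝ, V) 𝓘(ℝ, V) (extChartAt 𝓘(ℝ, V) u).symm y).IsInvertible := by
  have : IsManifold 𝓘(ℝ, V) 1 E := IsManifold.of_le (n := ∞) (by simp)
  simpa using isInvertible_mfderivWithin_extChartAt_symm (I := 𝓘(ℝ, V)) hy

theorem mdifferentiableAt_extChartAt_symm {u : E} {y : V}
    (hy : y ∈ (extChartAt 𝓘(ℝ, V) u).target) :
    MDifferentiableAt 𝓘(ℝ, V) 𝓘(ℝ, V) (extChartAt 𝓘(ℝ, V) u).symm y := by
  have : IsManifold 𝓘(ℝ, V) 1 E := IsManifold.of_le (n := ∞) (by simp)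
  exact ((contMDiffOn_extChartAt_symm (n := 1) u).contMDiffAt
    (extChartAt_target_nhds hy)).mdifferentiableAt one_ne_zero

theorem mfderiv_symm_chartVField {u : E} (X : VField V E) {y : V}
    (hy : y ∈ (extChartAt 𝓘(ℝ, V) u).target) :
    mfderiv 𝓘(ℝ, V) 𝓘(ℝ, V) (extChartAt 𝓘(ℝ, V) u).symm y (chartVField (V := V) u X y) =
      X ((extChartAt 𝓘(ℝ, V) u).symm y) :=
  (isInvertible_mfderiv_extChartAt_symm hy).self_apply_inverse _

theorem mfderiv_comp_extChartAt_symm {u : E} {y : V}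
    (hy : y ∈ (extChartAt 𝓘(ℝ, V) u).target) :
    (mfderiv 𝓘(ℝ, V) 𝓘(ℝ, V) (extChartAt 𝓘(ℝ, V) u) ((extChartAt 𝓘(ℝ, V) u).symm y)).comp
      (mfderiv 𝓘(ℝ, V) 𝓘(ℝ, V) (extChartAt 𝓘(ℝ, V) u).symm y) = ContinuousLinearMap.id ℝ _ := by
  have : IsManifold 𝓘(ℝ, V) 1 E := IsManifold.of_le (n := ∞) (by simp)
  simpa using mfderiv_extChartAt_comp_mfderivWithin_extChartAt_symm (I := 𝓘(ℝ, V)) hy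

theorem mfderiv_extChartAt_apply {u : E} (X : VField V E) {y : V}
    (hy : y ∈ (extChartAt 𝓘(ℝ, V) u).target) :
    mfderiv 𝓘(ℝ, V) 𝓘(ℝ, V) (extChartAt 𝓘(ℝ, V) u) ((extChartAt 𝓘(ℝ, V) u).symm y)
      (X ((extChartAt 𝓘(ℝ, V) u).symm y)) = chartVField u X y := by
  rw [← mfderiv_symm_chartVField X hy]
  exact DFunLike.congr_fun (mfderiv_comp_extChartAt_symm hy) (chartVField u X y)

theorem contMDiffAt_iff_chart {n : ℕ∞ω} {f : E → G} {u : E} :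
    ContMDiffAt 𝓘(ℝ, V) 𝓘(ℝ, G) n f u ↔
      ContDiffAt ℝ n (f ∘ (extChartAt 𝓘(ℝ, V) u).symm) (extChartAt 𝓘(ℝ, V) u u) := by
  rw [contMDiffAt_iff_source]
  simp [contMDiffWithinAt_univ, contMDiffAt_iff_contDiffAt]

theorem IsSmoothVFieldAt.contDiffAt {X : VField V E} {u : E} (hX : IsSmoothVFieldAt X u) :
    ContDiffAt ℝ ∞ (chartVField u X) (extChartAt 𝓘(ℝ, V) u u) := by
  have : IsManifold 𝓘(ℝ, V) 1 E := IsManifold.of_le (n := ∞) (by simp)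
  have h := contMDiffWithinAt_mpullbackWithin_extChartAt_symm (n := ∞)
    (contMDiffWithinAt_univ.2 hX) uniqueMDiffOn_univ (mem_univ u) (by simp)
  simp only [modelWithCornersSelf_coe, range_id, preimage_univ, inter_univ, mpullbackWithin_univ]
    at h
  exact contMDiffAt_vectorSpace_iff_contDiffAt.1
    (h.contMDiffAt (extChartAt_target_nhds (mem_extChartAt_target u)))

/-- The vector field on `E` with expression `R` in the preferred chart around `u`. -/
noncomputable def ofChart (u : E) (R : V → V) : VField V E :=
  mpullback 𝓘(ℝ, V) 𝓘(ℝ, V) (extChartAt 𝓘(ℝ, V) u) (R : VField V V)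

theorem mfderiv_extChartAt_ofChart {u z : E} (R : V → V)
    (hz : z ∈ (extChartAt 𝓘(ℝ, V) u).source) :
    mfderiv 𝓘(ℝ, V) 𝓘(ℝ, V) (extChartAt 𝓘(ℝ, V) u) z (ofChart u R z) =
      R (extChartAt 𝓘(ℝ, V) u z) := by
  have : IsManifold 𝓘(ℝ, V) 1 E := IsManifold.of_le (n := ∞) (by simp)
  exact (isInvertible_mfderiv_extChartAt hz).self_apply_inverse _

theorem chartVField_ofChart {u : E} (R : V → V) {y : V}
    (hy : y ∈ (extChartAt 𝓘(ℝ, V) u).target) :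
    chartVField u (ofChart u R) y = R y := by
  rw [← mfderiv_extChartAt_apply _ hy, mfderiv_extChartAt_ofChart]
  · rw [(extChartAt 𝓘(ℝ, V) u).right_inv hy]
  · exact (extChartAt 𝓘(ℝ, V) u).map_target hy

theorem isSmoothVFieldAt_ofChart {u : E} {R : V → V}
    (hR : ContDiffAt ℝ ∞ R (extChartAt 𝓘(ℝ, V) u u)) : IsSmoothVFieldAt (ofChart u R) u := by
  have : IsManifold 𝓘(ℝ, V) 1 E := IsManifold.of_le (n := ∞) (by simp)
  exact ContMDiffAt.mpullback_vectorField_preimage (n := ∞)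
    (V := (R : VField V V)) (contMDiffAt_vectorSpace_iff_contDiffAt.2 hR)
    contMDiffAt_extChartAt (isInvertible_mfderiv_extChartAt (mem_extChartAt_source u)) (by simp)

theorem eventuallyEq_of_chartVField {u : E} {X Y : VField V E}
    (h : chartVField u X =ᶠ[𝓝 (extChartAt 𝓘(ℝ, V) u u)] chartVField u Y) :
    X =ᶠ[𝓝 u] Y := by
  have h' := (continuousAt_extChartAt (I := 𝓘(ℝ, V)) u).eventually h
  filter_upwards [h', extChartAt_source_mem_nhds (I := 𝓘(ℝ, V)) u] with z hz hzs
  have ht := (extChartAt 𝓘(ℝ, V) u).map_source hzs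
  have hX := mfderiv_symm_chartVField X ht
  have hY := mfderiv_symm_chartVField Y ht
  rw [hz, hY] at hX
  rw [(extChartAt 𝓘(ℝ, V) u).left_inv hzs] at hX
  exact hX.symm

/-- For the converse, `X` agrees near `u` with the field rebuilt from its own chart expression. -/
theorem isSmoothVFieldAt_iff {X : VField V E} {u : E} :
    IsSmoothVFieldAt X u ↔ ContDiffAt ℝ ∞ (chartVField u X) (extChartAt 𝓘(ℝ, V) u u) := by
  refine ⟨fun h => h.contDiffAt, fun h => ?_⟩
  have e : X =ᶠ[𝓝 u] ofChart u (chartVField u X) := by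
    apply eventuallyEq_of_chartVField
    filter_upwards [extChartAt_target_nhds (mem_extChartAt_target u)] with y hy
    rw [chartVField_ofChart _ hy]
  refine (isSmoothVFieldAt_ofChart h).congr_of_eventuallyEq ?_
  filter_upwards [e] with z hz
  rw [hz]

/-- Turns pointwise identities into identities of fields; the witness has constant coefficients in
the chart. -/
theorem exists_isSmoothVFieldAt (u : E) (v : TangentSpace 𝓘(ℝ, V) u) :
    ∃ X : VField V E, IsSmoothVFieldAt X u ∧ X u = v := by
  have : IsManifold 𝓘(ℝ, V) 1 E := IsManifold.of_le (n := ∞) (by simp)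
  refine ⟨ofChart u (fun _ => mfderiv 𝓘(ℝ, V) 𝓘(ℝ, V) (extChartAt 𝓘(ℝ, V) u) u v),
    isSmoothVFieldAt_ofChart contDiffAt_const, ?_⟩
  exact (isInvertible_mfderiv_extChartAt (mem_extChartAt_source u)).inverse_apply_self v

theorem mvfderiv_apply_chart {f : E → G} (X : VField V E) {u : E} {y : V}
    (hy : y ∈ (extChartAt 𝓘(ℝ, V) u).target)
    (hf : MDifferentiableAt 𝓘(ℝ, V) 𝓘(ℝ, G) f ((extChartAt 𝓘(ℝ, V) u).symm y)) :
    mvfderiv 𝓘(ℝ, V) f ((extChartAt 𝓘(ℝ, V) u).symm y) (X ((extChartAt 𝓘(ℝ, V) u).symm y)) =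
      fderiv ℝ (f ∘ (extChartAt 𝓘(ℝ, V) u).symm) y (chartVField u X y) := by
  rw [← mfderiv_symm_chartVField X hy, ← mfderiv_eq_fderiv]
  exact (mfderiv_comp_apply y hf (mdifferentiableAt_extChartAt_symm hy) _).symm

theorem mvfderiv_apply_chart_self {f : E → G} (X : VField V E) {u : E}
    (hf : MDifferentiableAt 𝓘(ℝ, V) 𝓘(ℝ, G) f u) :
    mvfderiv 𝓘(ℝ, V) f u (X u) =
      fderiv ℝ (f ∘ (extChartAt 𝓘(ℝ, V) u).symm) (extChartAt 𝓘(ℝ, V) u u)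
        (chartVField u X (extChartAt 𝓘(ℝ, V) u u)) := by
  have h := mvfderiv_apply_chart (f := f) X (mem_extChartAt_target (I := 𝓘(ℝ, V)) u)
  rw [extChartAt_to_inv] at h
  exact h hf

/-- In the chart, `X f` is computed by the usual derivative. -/
theorem mvfderiv_apply_comp_symm_eventuallyEq {f : E → G} (X : VField V E) {u : E}
    (hf : ContMDiffAt 𝓘(ℝ, V) 𝓘(ℝ, G) ∞ f u) :
    (fun z => mvfderiv 𝓘(ℝ, V) f z (X z)) ∘ (extChartAt 𝓘(ℝ, V) u).symm
      =ᶠ[𝓝 (extChartAt 𝓘(ℝ, V) u u)]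
    fun y => fderiv ℝ (f ∘ (extChartAt 𝓘(ℝ, V) u).symm) y (chartVField u X y) := by
  have : IsManifold 𝓘(ℝ, V) 1 E := IsManifold.of_le (n := ∞) (by simp)
  have h1 : ∀ᶠ z in 𝓝 u, ContMDiffAt 𝓘(ℝ, V) 𝓘(ℝ, G) 1 f z :=
    (contMDiffAt_iff_contMDiffAt_nhds (by simp)).1 (hf.of_le (by simp))
  have h2 : Tendsto (extChartAt 𝓘(ℝ, V) u).symm (𝓝 (extChartAt 𝓘(ℝ, V) u u)) (𝓝 u) := by
    have := continuousAt_extChartAt_symm (I := 𝓘(ℝ, V)) u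
    rwa [ContinuousAt, extChartAt_to_inv] at this
  filter_upwards [h2.eventually h1, extChartAt_target_nhds (mem_extChartAt_target u)] with y hy ht
  exact mvfderiv_apply_chart X ht (hy.mdifferentiableAt one_ne_zero)

theorem contMDiffAt_mvfderiv_apply {f : E → G} {X : VField V E} {u : E}
    (hf : ContMDiffAt 𝓘(ℝ, V) 𝓘(ℝ, G) ∞ f u) (hX : IsSmoothVFieldAt X u) :
    ContMDiffAt 𝓘(ℝ, V) 𝓘(ℝ, G) ∞ (fun z => mvfderiv 𝓘(ℝ, V) f z (X z)) u := by
  rw [contMDiffAt_iff_chart]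
  refine ContDiffAt.congr_of_eventuallyEq ?_ (mvfderiv_apply_comp_symm_eventuallyEq X hf)
  exact ((contMDiffAt_iff_chart.1 hf).fderiv_right (m := ∞) (by simp)).clm_apply hX.contDiffAt

/-- The manifold bracket at `u` is by definition computed in the chart at `u`; hence the formula is
stated only at the center of that chart. -/
theorem chartVField_mlieBracket (X Y : VField V E) (u : E) :
    chartVField u (mlieBracket 𝓘(ℝ, V) X Y) (extChartAt 𝓘(ℝ, V) u u) =
      lieBracket ℝ (chartVField u X) (chartVField u Y) (extChartAt 𝓘(ℝ, V) u u) := by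
  have : IsManifold 𝓘(ℝ, V) 1 E := IsManifold.of_le (n := ∞) (by simp)
  rw [← mfderiv_extChartAt_apply _ (mem_extChartAt_target u), extChartAt_to_inv,
    ← mlieBracketWithin_univ, mlieBracketWithin_apply]
  have := (isInvertible_mfderiv_extChartAt (I := 𝓘(ℝ, V))
    (mem_extChartAt_source u)).self_apply_inverse
    (lieBracketWithin (E := V) ℝ (chartVField u X) (chartVField u Y) univ
      (extChartAt 𝓘(ℝ, V) u u))
  rw [← lieBracketWithin_univ]
  simp only [modelWithCornersSelf_coe, range_id, preimage_univ, inter_univ, mpullbackWithin_univ]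
  exact this

/-- A Lie bracket acts on functions as the commutator. -/
theorem mvfderiv_mlieBracket {f : E → G} {X Y : VField V E} {u : E}
    (hf : ContMDiffAt 𝓘(ℝ, V) 𝓘(ℝ, G) ∞ f u) (hX : IsSmoothVFieldAt X u)
    (hY : IsSmoothVFieldAt Y u) :
    mvfderiv 𝓘(ℝ, V) f u (mlieBracket 𝓘(ℝ, V) X Y u) =
      mvfderiv 𝓘(ℝ, V) (fun z => mvfderiv 𝓘(ℝ, V) f z (Y z)) u (X u) -
        mvfderiv 𝓘(ℝ, V) (fun z => mvfderiv 𝓘(ℝ, V) f z (X z)) u (Y u) := by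
  have h0 : (∞ : ℕ∞ω) ≠ 0 := by simp
  rw [mvfderiv_apply_chart_self _ (hf.mdifferentiableAt h0),
    mvfderiv_apply_chart_self _ ((contMDiffAt_mvfderiv_apply hf hX).mdifferentiableAt h0),
    mvfderiv_apply_chart_self _ ((contMDiffAt_mvfderiv_apply hf hY).mdifferentiableAt h0),
    (mvfderiv_apply_comp_symm_eventuallyEq X hf).fderiv_eq,
    (mvfderiv_apply_comp_symm_eventuallyEq Y hf).fderiv_eq, chartVField_mlieBracket]
  exact fderiv_apply_lieBracket (n := 2)
    ((contMDiffAt_iff_chart.1 hf).of_le (m := 2) (WithTop.coe_le_coe.2 (le_top : (2 : ℕ∞) ≤ ⊤))) (by simp)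
    (hY.contDiffAt.differentiableAt h0) (hX.contDiffAt.differentiableAt h0)

end Chart


/-! ### Differential forms in charts and the invariant formula for `d`. -/

section FormChart

/-- Evaluation `(a, v) ↦ a v` is a continuous polynomial map, linear in `a` and multilinear in `v`,
hence analytic. -/
theorem contDiffAt_continuousAlternatingMap_apply {H V : Type*}
    [NormedAddCommGroup H] [NormedSpace ℝ H] [NormedAddCommGroup V] [NormedSpace ℝ V] {ι : Type*} [Fintype ι] {n : ℕ∞ω}
    {a : H → V [⋀^ι]→L[ℝ] ℝ} {X : ι → H → V} {y : H} (ha : ContDiffAt ℝ n a y)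
    (hX : ∀ i, ContDiffAt ℝ n (X i) y) : ContDiffAt ℝ n (fun y => a y (fun i => X i y)) y := by
  let T := ContinuousAlternatingMap.toContinuousMultilinearMapCLM (E := V) (F := ℝ) (ι := ι)
    (𝕜 := ℝ) ℝ
  have h := (T.cpolynomialAt_uncurry_of_multilinear
    (x := (a y, fun i => X i y))).analyticAt.contDiffAt (n := n)
  exact h.comp y (f := fun y => (a y, fun i => X i y)) (ha.prodMk (contDiffAt_pi.2 hX))

variable {V : Type*} [NormedAddCommGroup V] [NormedSpace ℝ V] [FiniteDimensional ℝ V]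
  {E : Type*} [TopologicalSpace E] [ChartedSpace V E] [IsManifold 𝓘(ℝ, V) ∞ E] {k : ℕ}

theorem mfderiv_extChartAt_self (u : E) (X : VField V E) :
    mfderiv 𝓘(ℝ, V) 𝓘(ℝ, V) (extChartAt 𝓘(ℝ, V) u) u (X u) =
      chartVField u X (extChartAt 𝓘(ℝ, V) u u) := by
  have h := mfderiv_extChartAt_apply X (mem_extChartAt_target (I := 𝓘(ℝ, V)) u)
  rwa [extChartAt_to_inv] at h

theorem Form.inChart_chartVField (α : Form V E k) (X : Fin k → VField V E) {u : E} {y : V}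
    (hy : y ∈ (extChartAt 𝓘(ℝ, V) u).target) :
    α.inChart u y (fun i => chartVField u (X i) y) =
      α ((extChartAt 𝓘(ℝ, V) u).symm y) (fun i => X i ((extChartAt 𝓘(ℝ, V) u).symm y)) := by
  refine (congrArg (α ((extChartAt 𝓘(ℝ, V) u).symm y)) (funext fun i => ?_))
  exact mfderiv_symm_chartVField (X i) hy

theorem Form.comp_symm_eventuallyEq (α : Form V E k) (X : Fin k → VField V E) (u : E) :
    (fun z => α z (fun i => X i z)) ∘ (extChartAt 𝓘(ℝ, V) u).symm
      =ᶠ[𝓝 (extChartAt 𝓘(ℝ, V) u u)]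
    fun y => α.inChart u y (fun i => chartVField u (X i) y) := by
  filter_upwards [extChartAt_target_nhds (mem_extChartAt_target u)] with y hy
  exact (α.inChart_chartVField X hy).symm

theorem Form.IsSmooth.contDiffAt {α : Form V E k} (hα : α.IsSmooth) (u : E) :
    ContDiffAt ℝ ∞ (α.inChart u) (extChartAt 𝓘(ℝ, V) u u) :=
  (hα u).contDiffAt (extChartAt_target_nhds (mem_extChartAt_target u))

theorem Form.IsSmooth.contMDiffAt_apply {α : Form V E k} (hα : α.IsSmooth)
    {X : Fin k → VField V E} {u : E} (hX : ∀ i, IsSmoothVFieldAt (X i) u) :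
    ContMDiffAt 𝓘(ℝ, V) 𝓘(ℝ, ℝ) ∞ (fun z => α z (fun i => X i z)) u := by
  rw [contMDiffAt_iff_chart]
  exact (contDiffAt_continuousAlternatingMap_apply (hα.contDiffAt u)
    fun i => (hX i).contDiffAt).congr_of_eventuallyEq (α.comp_symm_eventuallyEq X u)

theorem Form.IsSmooth.mvfderiv_apply {α : Form V E k} (hα : α.IsSmooth)
    {X : Fin k → VField V E} {u : E} (hX : ∀ i, IsSmoothVFieldAt (X i) u) (Z : VField V E) :
    mvfderiv 𝓘(ℝ, V) (fun z => α z (fun i => X i z)) u (Z u) =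
      fderiv ℝ (fun y => α.inChart u y (fun i => chartVField u (X i) y))
        (extChartAt 𝓘(ℝ, V) u u) (chartVField u Z (extChartAt 𝓘(ℝ, V) u u)) := by
  rw [mvfderiv_apply_chart_self _ ((hα.contMDiffAt_apply hX).mdifferentiableAt (by simp)),
    (α.comp_symm_eventuallyEq X u).fderiv_eq]

/-- The invariant formula for the exterior derivative. -/
theorem Form.IsSmooth.d_apply {α : Form V E (k + 1)} (hα : α.IsSmooth)
    {X : Fin (k + 2) → VField V E} {u : E} (hX : ∀ i, IsSmoothVFieldAt (X i) u) :
    α.d u (fun i => X i u) =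
      (∑ i, (-1) ^ i.val • mvfderiv 𝓘(ℝ, V)
        (fun z => α z (fun j => i.removeNth X j z)) u (X i u)) -
      ∑ i : Fin (k + 1), ∑ j ≥ i, (-1) ^ (i + j : ℕ) •
        α u (Matrix.vecCons (mlieBracket 𝓘(ℝ, V) (X i.castSucc) (X j.succ) u)
          (fun l => j.removeNth (i.castSucc.removeNth X) l u)) := by
  have h0 : (∞ : ℕ∞ω) ≠ 0 := by simp
  set y₀ := extChartAt 𝓘(ℝ, V) u u with hy₀
  have h1 : α.d u (fun i => X i u) =
      extDeriv (α.inChart u) y₀ (fun i => chartVField u (X i) y₀) := by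
    refine congrArg (extDeriv (α.inChart u) y₀) (funext fun i => ?_)
    exact mfderiv_extChartAt_self u (X i)
  -- At the center of the chart this is the formula on the vector space `V`; the derivative terms
  -- and the bracket terms are then carried back separately.
  rw [h1, extDeriv_apply_vectorField ((hα.contDiffAt u).differentiableAt h0)
    (V := fun i => chartVField u (X i)) fun i => (hX i).contDiffAt.differentiableAt h0]
  congr 1
  · refine Finset.sum_congr rfl fun i _ => ?_
    rw [hα.mvfderiv_apply (X := i.removeNth X) (fun j => hX _)]
    rfl
  · refine Finset.sum_congr rfl fun i _ => Finset.sum_congr rfl fun j _ => ?_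
    congr 1
    have h2 := α.inChart_chartVField
      (Matrix.vecCons (mlieBracket 𝓘(ℝ, V) (X i.castSucc) (X j.succ))
        (j.removeNth (i.castSucc.removeNth X)))
      (mem_extChartAt_target (I := 𝓘(ℝ, V)) u)
    rw [extChartAt_to_inv] at h2
    convert h2 using 2
    · funext l
      refine Fin.cases ?_ (fun l => ?_) l
      · exact (chartVField_mlieBracket _ _ u).symm
      · rfl
    · funext l
      refine Fin.cases ?_ (fun l => ?_) l <;> rfl

theorem Form.IsSmooth.d_apply_one {Θ : Form V E 1} (hΘ : Θ.IsSmooth) {X Y : VField V E} {u : E}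
    (hX : IsSmoothVFieldAt X u) (hY : IsSmoothVFieldAt Y u) :
    Θ.d u ![X u, Y u] = mvfderiv 𝓘(ℝ, V) (fun z => Θ z ![Y z]) u (X u) -
      mvfderiv 𝓘(ℝ, V) (fun z => Θ z ![X z]) u (Y u) - Θ u ![mlieBracket 𝓘(ℝ, V) X Y u] := by
  let T : Fin 2 → VField V E := ![X, Y]
  have h : Θ.d u (fun i => T i u) = (∑ i : Fin 2, (-1) ^ i.val • mvfderiv 𝓘(ℝ, V)
      (fun z => Θ z (fun j => i.removeNth T j z)) u (T i u)) -
      ∑ i : Fin 1, ∑ j ≥ i, (-1) ^ (i + j : ℕ) •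
        Θ u (Matrix.vecCons (mlieBracket 𝓘(ℝ, V) (T i.castSucc) (T j.succ) u)
          (fun l => j.removeNth (i.castSucc.removeNth T) l u)) :=
    hΘ.d_apply (by intro i; fin_cases i <;> assumption)
  have e : (fun i => T i u) = ![X u, Y u] := by
    funext i; fin_cases i <;> rfl
  rw [e] at h
  have s0 : Finset.Ici (0 : Fin 1) = {0} := by decide
  simp only [Fin.sum_univ_two, Fin.sum_univ_one, s0, Finset.sum_singleton] at h
  have e0 (z : E) : (fun j => (0 : Fin 2).removeNth T j z) =
      ![Y z] := by
    funext j; fin_cases j; rfl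
  have e1 (z : E) : (fun j => (1 : Fin 2).removeNth T j z) =
      ![X z] := by
    funext j; fin_cases j; rfl
  simp only [e0, e1] at h
  have e2 (v : TangentSpace 𝓘(ℝ, V) u) (w : Fin 0 → TangentSpace 𝓘(ℝ, V) u) :
      Matrix.vecCons v w = ![v] := by
    funext j; fin_cases j; rfl
  -- The signs in `h` are integers acting on reals. The later field of each bracket has index `j +
  -- 1`, so the exponent is `i + j` and the whole bracket sum is subtracted.
  have key (a b c d : ℝ) (hc : c = d) :
      (-1 : ℤ) ^ 0 • a + (-1 : ℤ) ^ 1 • b - (-1 : ℤ) ^ 0 • c = a - b - d := by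
    simp [← sub_eq_add_neg, hc]
  exact h.trans (key _ _ _ _ (congrArg (Θ u) (e2 _ _)))

theorem Form.IsSmooth.d_apply_two {Ω : Form V E 2} (hΩ : Ω.IsSmooth) {X Y Z : VField V E} {u : E}
    (hX : IsSmoothVFieldAt X u) (hY : IsSmoothVFieldAt Y u) (hZ : IsSmoothVFieldAt Z u) :
    Ω.d u ![X u, Y u, Z u] = mvfderiv 𝓘(ℝ, V) (fun z => Ω z ![Y z, Z z]) u (X u) -
      mvfderiv 𝓘(ℝ, V) (fun z => Ω z ![X z, Z z]) u (Y u) +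
      mvfderiv 𝓘(ℝ, V) (fun z => Ω z ![X z, Y z]) u (Z u) -
      Ω u ![mlieBracket 𝓘(ℝ, V) X Y u, Z u] + Ω u ![mlieBracket 𝓘(ℝ, V) X Z u, Y u] -
      Ω u ![mlieBracket 𝓘(ℝ, V) Y Z u, X u] := by
  let T : Fin 3 → VField V E := ![X, Y, Z]
  have h : Ω.d u (fun i => T i u) = (∑ i : Fin 3, (-1) ^ i.val • mvfderiv 𝓘(ℝ, V)
      (fun z => Ω z (fun j => i.removeNth T j z)) u (T i u)) -
      ∑ i : Fin 2, ∑ j ≥ i, (-1) ^ (i + j : ℕ) •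
        Ω u (Matrix.vecCons (mlieBracket 𝓘(ℝ, V) (T i.castSucc) (T j.succ) u)
          (fun l => j.removeNth (i.castSucc.removeNth T) l u)) :=
    hΩ.d_apply (by intro i; fin_cases i <;> assumption)
  have e : (fun i => T i u) = ![X u, Y u, Z u] := by
    funext i; fin_cases i <;> rfl
  rw [e] at h
  have s0 : Finset.Ici (0 : Fin 2) = {0, 1} := by decide
  have s1 : Finset.Ici (1 : Fin 2) = {1} := by decide
  simp only [Fin.sum_univ_three, Fin.sum_univ_two, s0, s1, Finset.sum_singleton,
    Finset.sum_pair (zero_ne_one (α := Fin 2))] at h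
  have e0 (z : E) : (fun j => (0 : Fin 3).removeNth T j z) =
      ![Y z, Z z] := by
    funext j; fin_cases j <;> rfl
  have e1 (z : E) : (fun j => (1 : Fin 3).removeNth T j z) =
      ![X z, Z z] := by
    funext j; fin_cases j <;> rfl
  have e2 (z : E) : (fun j => (2 : Fin 3).removeNth T j z) =
      ![X z, Y z] := by
    funext j; fin_cases j <;> rfl
  simp only [e0, e1, e2] at h
  have f0 : (fun l => (0 : Fin 2).removeNth
      ((0 : Fin 2).castSucc.removeNth T) l u) = ![Z u] := by
    funext j; fin_cases j; rfl
  have f1 : (fun l => (1 : Fin 2).removeNth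
      ((0 : Fin 2).castSucc.removeNth T) l u) = ![Y u] := by
    funext j; fin_cases j; rfl
  have f2 : (fun l => (1 : Fin 2).removeNth
      ((1 : Fin 2).castSucc.removeNth T) l u) = ![X u] := by
    funext j; fin_cases j; rfl
  rw [f0, f1, f2] at h
  have key (a b c d e f : ℝ) : (-1 : ℤ) ^ 0 • a + (-1 : ℤ) ^ 1 • b + (-1 : ℤ) ^ 2 • c -
      ((-1 : ℤ) ^ 0 • d + (-1 : ℤ) ^ 1 • e + (-1 : ℤ) ^ 2 • f) = a - b + c - d + e - f := by
    simp
    ring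
  exact h.trans (key _ _ _ _ _ _)

end FormChart


/-! ### Local lifts along a submersion and related vector fields. -/

section Lift

/-- A smooth family of surjective operators has a smooth family of right inverses. -/
theorem exists_contDiffAt_rightInverse {H V B : Type*} [NormedAddCommGroup H] [NormedSpace ℝ H]
    [NormedAddCommGroup V] [NormedSpace ℝ V] [NormedAddCommGroup B] [NormedSpace ℝ B]
    [FiniteDimensional ℝ B] {n : ℕ∞ω} {D : H → V →L[ℝ] B} {y₀ : H} (hD : ContDiffAt ℝ n D y₀)
    (hs : Function.Surjective (D y₀)) :
    ∃ R : H → B →L[ℝ] V, ContDiffAt ℝ n R y₀ ∧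
      ∀ᶠ y in 𝓝 y₀, ∀ b, D y (R y b) = b := by
  have : CompleteSpace B := FiniteDimensional.complete ℝ B
  obtain ⟨g, hg⟩ := (D y₀).toLinearMap.exists_rightInverse_of_surjective
    (LinearMap.range_eq_top.2 hs)
  let R₀ : B →L[ℝ] V := LinearMap.toContinuousLinearMap g
  have h0 : (D y₀).comp R₀ = (ContinuousLinearEquiv.refl ℝ B : B →L[ℝ] B) := by
    ext b
    exact LinearMap.congr_fun hg b
  have hDR : ContDiffAt ℝ n (fun y => (D y).comp R₀) y₀ := hD.clm_comp contDiffAt_const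
  -- A fixed right inverse `R₀` of `D y₀` makes `D y ∘ R₀` the identity at `y₀`, hence invertible
  -- nearby with smooth inverse.
  refine ⟨fun y => R₀.comp ((D y).comp R₀).inverse, contDiffAt_const.clm_comp ?_, ?_⟩
  · refine ContDiffAt.comp y₀ (g := ContinuousLinearMap.inverse) ?_ hDR
    rw [h0]
    exact contDiffAt_map_inverse _
  · have hn := (ContinuousLinearEquiv.refl ℝ B).nhds
    rw [← h0] at hn
    filter_upwards [hDR.continuousAt hn] with y ⟨e, he⟩ b
    have hi : ((D y).comp R₀).IsInvertible := ⟨e, he⟩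
    exact hi.self_apply_inverse b

variable {V : Type*} [NormedAddCommGroup V] [NormedSpace ℝ V] [FiniteDimensional ℝ V]
  {E : Type*} [TopologicalSpace E] [ChartedSpace V E] [IsManifold 𝓘(ℝ, V) ∞ E]
  {B : Type*} [NormedAddCommGroup B] [NormedSpace ℝ B] [FiniteDimensional ℝ B]
  {M : Type*} [TopologicalSpace M] [ChartedSpace B M] [IsManifold 𝓘(ℝ, B) ∞ M]

theorem mvfderiv_extChartAt_comp {p : E → M} (hp : ContMDiff 𝓘(ℝ, V) 𝓘(ℝ, B) ∞ p) {u z : E}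
    (hz : p z ∈ (extChartAt 𝓘(ℝ, B) (p u)).source) (v : TangentSpace 𝓘(ℝ, V) z) :
    mvfderiv 𝓘(ℝ, V) (extChartAt 𝓘(ℝ, B) (p u) ∘ p) z v =
      mvfderiv 𝓘(ℝ, B) (extChartAt 𝓘(ℝ, B) (p u)) (p z) (mfderiv 𝓘(ℝ, V) 𝓘(ℝ, B) p z v) := by
  have : IsManifold 𝓘(ℝ, B) 1 M := IsManifold.of_le (n := ∞) (by simp)
  exact mfderiv_comp_apply z (mdifferentiableAt_extChartAt (by simpa using hz))
    ((hp z).mdifferentiableAt (by simp)) v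

theorem mvfderiv_extChartAt_injective {x₀ x : M} (hx : x ∈ (extChartAt 𝓘(ℝ, B) x₀).source) :
    Function.Injective (mvfderiv 𝓘(ℝ, B) (extChartAt 𝓘(ℝ, B) x₀) x) := by
  have : IsManifold 𝓘(ℝ, B) 1 M := IsManifold.of_le (n := ∞) (by simp)
  exact (isInvertible_mfderiv_extChartAt hx).injective

theorem contMDiffAt_extChartAt_comp {p : E → M} (hp : ContMDiff 𝓘(ℝ, V) 𝓘(ℝ, B) ∞ p) (u : E) :
    ContMDiffAt 𝓘(ℝ, V) 𝓘(ℝ, B) ∞ (extChartAt 𝓘(ℝ, B) (p u) ∘ p) u :=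
  ContMDiffAt.comp u contMDiffAt_extChartAt (hp u)

/-- Along a submersion a vector field has local lifts with prescribed value at a point. -/
theorem exists_local_lift {p : E → M} (hp : ContMDiff 𝓘(ℝ, V) 𝓘(ℝ, B) ∞ p) {u : E}
    (hs : Function.Surjective (mfderiv 𝓘(ℝ, V) 𝓘(ℝ, B) p u)) {X : VField B M}
    (hX : IsSmoothVFieldAt X (p u)) (v : TangentSpace 𝓘(ℝ, V) u)
    (hv : mfderiv 𝓘(ℝ, V) 𝓘(ℝ, B) p u v = X (p u)) :
    ∃ Z : VField V E, IsSmoothVFieldAt Z u ∧ Z u = v ∧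
      ∀ᶠ z in 𝓝 u, mfderiv 𝓘(ℝ, V) 𝓘(ℝ, B) p z (Z z) = X (p z) := by
  have i1 : IsManifold 𝓘(ℝ, B) 1 M := IsManifold.of_le (n := ∞) (by simp)
  have i2 : IsManifold 𝓘(ℝ, V) 1 E := IsManifold.of_le (n := ∞) (by simp)
  set φ := extChartAt 𝓘(ℝ, V) u with hφ
  set ψ := extChartAt 𝓘(ℝ, B) (p u) with hψ
  have hpc := contMDiffAt_extChartAt_comp hp u
  let q : V → B := (ψ ∘ p) ∘ φ.symm
  have hq : ContDiffAt ℝ ∞ q (φ u) := contMDiffAt_iff_chart.1 hpc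
  let D : V → V →L[ℝ] B := fderiv ℝ q
  have hD : ContDiffAt ℝ ∞ D (φ u) := hq.fderiv_right (by simp)
  have hDX (Z : VField V E) : D (φ u) (chartVField u Z (φ u)) =
      mvfderiv 𝓘(ℝ, B) ψ (p u) (mfderiv 𝓘(ℝ, V) 𝓘(ℝ, B) p u (Z u)) := by
    rw [← mvfderiv_extChartAt_comp hp (mem_extChartAt_source (p u))]
    exact (mvfderiv_apply_chart_self Z (hpc.mdifferentiableAt (by simp))).symm
  have hsD : Function.Surjective (D (φ u)) := by
    intro b
    obtain ⟨b', hb'⟩ : ∃ b', mvfderiv 𝓘(ℝ, B) ψ (p u) b' = b :=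
      (isInvertible_mfderiv_extChartAt (mem_extChartAt_source (p u))).surjective b
    obtain ⟨w, hw⟩ := hs b'
    obtain ⟨Z, -, hZ⟩ := exists_isSmoothVFieldAt u w
    exact ⟨chartVField u Z (φ u), by rw [hDX, hZ, hw, hb']⟩
  obtain ⟨R, hR, hDR⟩ := exists_contDiffAt_rightInverse hD hsD
  obtain ⟨W, hW, hWv⟩ := exists_isSmoothVFieldAt u v
  let Xc : V → B := fun y => chartVField (p u) X (q y)
  have hqu : q (φ u) = ψ (p u) := by simp [q, φ]
  have hXc : ContDiffAt ℝ ∞ Xc (φ u) := by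
    refine ContDiffAt.comp (φ u) (g := chartVField (p u) X) ?_ hq
    rw [hqu]
    exact hX.contDiffAt
  -- `W` has the right value at `u` but need not project onto `X`; the right inverse `R` corrects
  -- the error, which vanishes at `u`.
  let Zc : V → V := fun y => chartVField u W y + R y (Xc y - D y (chartVField u W y))
  have hZc : ContDiffAt ℝ ∞ Zc (φ u) :=
    hW.contDiffAt.add (hR.clm_apply (hXc.sub (hD.clm_apply hW.contDiffAt)))
  have hXu : Xc (φ u) = D (φ u) (chartVField u W (φ u)) := by
    rw [hDX, hWv, hv]
    simp only [Xc, hqu]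
    exact (mfderiv_extChartAt_self (p u) X).symm
  have hZcu : Zc (φ u) = chartVField u W (φ u) := by
    simp [Zc, hXu]
  refine ⟨ofChart u Zc, isSmoothVFieldAt_ofChart hZc, ?_, ?_⟩
  · refine (isInvertible_mfderiv_extChartAt (mem_extChartAt_source u)).injective ?_
    rw [mfderiv_extChartAt_ofChart _ (mem_extChartAt_source u), ← hWv, mfderiv_extChartAt_self]
    exact hZcu
  · have hc := continuousAt_extChartAt (I := 𝓘(ℝ, V)) u
    have e1 := hc.eventually (mvfderiv_apply_comp_symm_eventuallyEq (ofChart u Zc) hpc)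
    filter_upwards [e1, hc.eventually hDR, extChartAt_source_mem_nhds (I := 𝓘(ℝ, V)) u,
      hp.continuous.continuousAt.preimage_mem_nhds
        (extChartAt_source_mem_nhds (I := 𝓘(ℝ, B)) (p u))] with z h1 h2 h3 h4
    apply mvfderiv_extChartAt_injective h4
    rw [← mvfderiv_extChartAt_comp hp h4]
    have ht := φ.map_source h3
    have hz : φ.symm (φ z) = z := φ.left_inv h3
    rw [chartVField_ofChart _ ht] at h1
    simp only [Function.comp_apply] at h1
    change mvfderiv 𝓘(ℝ, V) (ψ ∘ p) (φ.symm (φ z)) (ofChart u Zc (φ.symm (φ z))) =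
      D (φ z) (Zc (φ z)) at h1
    rw [hz] at h1
    rw [h1]
    have h5 : D (φ z) (Zc (φ z)) = Xc (φ z) := by
      simp only [Zc]
      rw [map_add, h2, add_sub_cancel]
    have h6 := mfderiv_extChartAt_apply X (ψ.map_source h4)
    rw [ψ.left_inv h4] at h6
    rw [h5]
    simp only [Xc, q, Function.comp_apply, hz]
    exact h6.symm

/-- Brackets of related vector fields are related. -/
theorem mfderiv_mlieBracket {p : E → M} (hp : ContMDiff 𝓘(ℝ, V) 𝓘(ℝ, B) ∞ p) {u : E}
    {Z₁ Z₂ : VField V E} {X₁ X₂ : VField B M}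
    (hZ₁ : IsSmoothVFieldAt Z₁ u) (hZ₂ : IsSmoothVFieldAt Z₂ u)
    (hX₁ : IsSmoothVFieldAt X₁ (p u)) (hX₂ : IsSmoothVFieldAt X₂ (p u))
    (h₁ : ∀ᶠ z in 𝓝 u, mfderiv 𝓘(ℝ, V) 𝓘(ℝ, B) p z (Z₁ z) = X₁ (p z))
    (h₂ : ∀ᶠ z in 𝓝 u, mfderiv 𝓘(ℝ, V) 𝓘(ℝ, B) p z (Z₂ z) = X₂ (p z)) :
    mfderiv 𝓘(ℝ, V) 𝓘(ℝ, B) p u (mlieBracket 𝓘(ℝ, V) Z₁ Z₂ u) =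
      mlieBracket 𝓘(ℝ, B) X₁ X₂ (p u) := by
  set ψ := extChartAt 𝓘(ℝ, B) (p u) with hψ
  have hψs : ContMDiffAt 𝓘(ℝ, B) 𝓘(ℝ, B) ∞ ψ (p u) := contMDiffAt_extChartAt
  have key {Z : VField V E} {X : VField B M}
      (h : ∀ᶠ z in 𝓝 u, mfderiv 𝓘(ℝ, V) 𝓘(ℝ, B) p z (Z z) = X (p z)) :
      -- Relatedness tested on the chart `ψ`: `Z(ψ ∘ p) = (Xψ) ∘ p` near `u`. Both brackets act as
      -- commutators, and the derivative of `ψ` is injective.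
      (fun z => mvfderiv 𝓘(ℝ, V) (ψ ∘ p) z (Z z)) =ᶠ[𝓝 u]
        (fun x => mvfderiv 𝓘(ℝ, B) ψ x (X x)) ∘ p := by
    filter_upwards [h, hp.continuous.continuousAt.preimage_mem_nhds
        (extChartAt_source_mem_nhds (I := 𝓘(ℝ, B)) (p u))] with z h1 h2
    rw [mvfderiv_extChartAt_comp hp h2, h1]
    rfl
  have key2 {X : VField B M} (hX : IsSmoothVFieldAt X (p u)) (v : TangentSpace 𝓘(ℝ, V) u) :
      mvfderiv 𝓘(ℝ, V) ((fun x => mvfderiv 𝓘(ℝ, B) ψ x (X x)) ∘ p) u v =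
      mvfderiv 𝓘(ℝ, B) (fun x => mvfderiv 𝓘(ℝ, B) ψ x (X x)) (p u)
        (mfderiv 𝓘(ℝ, V) 𝓘(ℝ, B) p u v) :=
    mfderiv_comp_apply u ((contMDiffAt_mvfderiv_apply hψs hX).mdifferentiableAt (by simp))
      ((hp u).mdifferentiableAt (by simp)) v
  have key3 {f g : E → B} (h : f =ᶠ[𝓝 u] g) : mvfderiv 𝓘(ℝ, V) f u = mvfderiv 𝓘(ℝ, V) g u := by
    ext v
    exact DFunLike.congr_fun h.mfderiv_eq v
  apply mvfderiv_extChartAt_injective (mem_extChartAt_source (p u))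
  rw [← mvfderiv_extChartAt_comp hp (mem_extChartAt_source (p u)),
    mvfderiv_mlieBracket (contMDiffAt_extChartAt_comp hp u) hZ₁ hZ₂,
    mvfderiv_mlieBracket hψs hX₁ hX₂, key3 (key h₁), key3 (key h₂), key2 hX₁, key2 hX₂,
    h₁.self_of_nhds, h₂.self_of_nhds]

variable {W : Type*} [NormedAddCommGroup W] [NormedSpace ℝ W]
  {F : Type*} [TopologicalSpace F] [ChartedSpace W F]

omit [FiniteDimensional ℝ V] [IsManifold 𝓘(ℝ, V) ∞ E] [FiniteDimensional ℝ B]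
  [IsManifold 𝓘(ℝ, B) ∞ M] in
theorem IsSmoothFiberBundle.surjective [Nonempty F] {p : E → M}
    (hp : IsSmoothFiberBundle V B W F p) : Function.Surjective p := by
  intro x
  obtain ⟨e, hx, -⟩ := hp.locally_trivial x
  exact ⟨_, e.proj_symm_apply' (x := Classical.arbitrary F) hx⟩

/-- In a smooth trivialization `p` becomes the first projection, whose derivative is onto. -/
theorem IsSmoothFiberBundle.mfderiv_surjective {p : E → M}
    (hp : IsSmoothFiberBundle V B W F p) (u : E) :
    Function.Surjective (mfderiv 𝓘(ℝ, V) 𝓘(ℝ, B) p u) := by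
  intro v
  obtain ⟨e, hx, -, he⟩ := hp.locally_trivial (p u)
  have hu : u ∈ e.source := e.mem_source.2 hx
  have ht : e u ∈ e.target := e.map_source hu
  have hinv : e.toOpenPartialHomeomorph.symm (e u) = u := e.left_inv hu
  have hd : MDifferentiableAt (𝓘(ℝ, B).prod 𝓘(ℝ, W)) 𝓘(ℝ, V)
      e.toOpenPartialHomeomorph.symm (e u) :=
    (he.contMDiffAt (e.open_target.mem_nhds ht)).mdifferentiableAt (by simp)
  have hpd : MDifferentiableAt 𝓘(ℝ, V) 𝓘(ℝ, B) p (e.toOpenPartialHomeomorph.symm (e u)) :=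
    (hp.smooth _).mdifferentiableAt (by simp)
  have hfst : p ∘ e.toOpenPartialHomeomorph.symm =ᶠ[𝓝 (e u)] Prod.fst := by
    filter_upwards [e.open_target.mem_nhds ht] with w hw
    exact e.proj_symm_apply hw
  have h := mfderiv_comp (e u) hpd hd
  rw [hfst.mfderiv_eq, mfderiv_fst] at h
  have h' := DFunLike.congr_fun h (show TangentSpace (𝓘(ℝ, B).prod 𝓘(ℝ, W)) (e u) from
    ((v : B), (0 : W)))
  rw [hinv] at h'
  exact ⟨_, h'.symm⟩

end Lift


/-! ### Hamiltonian vector fields and the Poisson algebra. -/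

section Symplectic

theorem alternating_two_swap {T : Type*} [AddCommGroup T] [Module ℝ T] [TopologicalSpace T]
    (a : T [⋀^Fin 2]→L[ℝ] ℝ) (v w : T) : a ![v, w] = -a ![w, v] := by
  have h := a.toAlternatingMap.map_swap ![w, v] (zero_ne_one (α := Fin 2))
  have e : (![w, v] : Fin 2 → T) ∘ Equiv.swap (0 : Fin 2) 1 = ![v, w] := by
    funext i; fin_cases i <;> simp
  rw [e] at h
  exact h

theorem alternating_two_sub {T : Type*} [AddCommGroup T] [Module ℝ T] [TopologicalSpace T]
    (a : T [⋀^Fin 2]→L[ℝ] ℝ) (v v' w : T) : a ![v - v', w] = a ![v, w] - a ![v', w] := by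
  have h := a.vecCons_add ![w] v' (v - v')
  rw [add_sub_cancel] at h
  exact eq_sub_of_add_eq' h.symm

/-- The operator `v ↦ a (v, ·)` of an alternating form `a`. -/
noncomputable def flat {V : Type*} [NormedAddCommGroup V] [NormedSpace ℝ V]
    [FiniteDimensional ℝ V] (a : V [⋀^Fin 2]→L[ℝ] ℝ) : V →L[ℝ] V →L[ℝ] ℝ :=
  LinearMap.toContinuousLinearMap
    ((LinearMap.toContinuousLinearMap : (V →ₗ[ℝ] ℝ) ≃ₗ[ℝ] V →L[ℝ] ℝ).toLinearMap ∘ₗ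
      LinearMap.mk₂ ℝ (fun v w => a ![v, w])
        (fun v v' w => a.vecCons_add _ v v') (fun c v w => a.vecCons_smul _ c v)
        (fun v w w' => by
          rw [alternating_two_swap, a.vecCons_add, alternating_two_swap a v w,
            alternating_two_swap a v w', neg_add])
        (fun c v w => by
          rw [alternating_two_swap, a.vecCons_smul, alternating_two_swap a v w, smul_neg]))

/-- Nondegeneracy is injectivity, and `V` and its dual have the same finite dimension. -/
theorem isInvertible_flat {V : Type*} [NormedAddCommGroup V] [NormedSpace ℝ V]
    [FiniteDimensional ℝ V] {a : V [⋀^Fin 2]→L[ℝ] ℝ} (h : ∀ v, (∀ w, a ![v, w] = 0) → v = 0) :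
    (flat a).IsInvertible := by
  have hinj : Function.Injective (flat a).toLinearMap := by
    rw [← LinearMap.ker_eq_bot, LinearMap.ker_eq_bot']
    intro v hv
    exact h v fun w => DFunLike.congr_fun hv w
  have hr : Module.finrank ℝ V = Module.finrank ℝ (V →L[ℝ] ℝ) := by
    rw [← (LinearMap.toContinuousLinearMap : (V →ₗ[ℝ] ℝ) ≃ₗ[ℝ] V →L[ℝ] ℝ).finrank_eq]
    exact Subspace.dual_finrank_eq.symm
  exact ⟨(LinearEquiv.ofBijective (flat a).toLinearMap ⟨hinj,
    (LinearMap.injective_iff_surjective_of_finrank_eq_finrank hr).1 hinj⟩).toContinuousLinearEquiv,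
    by ext; rfl⟩

variable {V : Type*} [NormedAddCommGroup V] [NormedSpace ℝ V] [FiniteDimensional ℝ V]
  {E : Type*} [TopologicalSpace E] [ChartedSpace V E] [IsManifold 𝓘(ℝ, V) ∞ E]
  {Ω : Form V E 2}

theorem mvfderiv_congr {G : Type*} [NormedAddCommGroup G] [NormedSpace ℝ G] {f g : E → G} {u : E}
    (h : f =ᶠ[𝓝 u] g) : mvfderiv 𝓘(ℝ, V) f u = mvfderiv 𝓘(ℝ, V) g u := by
  ext v
  exact DFunLike.congr_fun h.mfderiv_eq v

theorem IsSymplectic.eq_of_forall (hΩ : IsSymplectic Ω) {u : E} {v v' : TangentSpace 𝓘(ℝ, V) u}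
    (h : ∀ w, Ω u ![v, w] = Ω u ![v', w]) : v = v' := by
  rw [← sub_eq_zero]
  exact hΩ.nondegenerate u _ fun w => by rw [alternating_two_sub, h, sub_self]

theorem IsSymplectic.eq_hamiltonian (hΩ : IsSymplectic Ω) {f : E → ℝ} {u : E}
    {v : TangentSpace 𝓘(ℝ, V) u} (h : ∀ w, Ω u ![v, w] = mvfderiv 𝓘(ℝ, V) f u w) :
    v = hamiltonian Ω f u :=
  hΩ.eq_of_forall fun w => by rw [h, hamiltonian_spec hΩ]

theorem Form.inChart_two (Ω : Form V E 2) (X Y : VField V E) {u : E} {y : V}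
    (hy : y ∈ (extChartAt 𝓘(ℝ, V) u).target) :
    Ω.inChart u y ![chartVField u X y, chartVField u Y y] =
      Ω ((extChartAt 𝓘(ℝ, V) u).symm y)
        ![X ((extChartAt 𝓘(ℝ, V) u).symm y), Y ((extChartAt 𝓘(ℝ, V) u).symm y)] := by
  have h := Ω.inChart_chartVField ![X, Y] hy
  convert h using 2 <;> (funext i; fin_cases i <;> rfl)

theorem IsSymplectic.isInvertible_flat_inChart (hΩ : IsSymplectic Ω) {u : E} {y : V}
    (hy : y ∈ (extChartAt 𝓘(ℝ, V) u).target) : (flat (Ω.inChart u y)).IsInvertible := by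
  refine isInvertible_flat fun v hv => ?_
  refine (isInvertible_mfderiv_extChartAt_symm hy).injective ?_
  refine Eq.trans (hΩ.nondegenerate _ _ fun w => ?_) (map_zero _).symm
  obtain ⟨w', rfl⟩ := (isInvertible_mfderiv_extChartAt_symm hy).surjective w
  have h : Ω.inChart u y ![v, w'] = Ω ((extChartAt 𝓘(ℝ, V) u).symm y)
      ![mfderiv 𝓘(ℝ, V) 𝓘(ℝ, V) (extChartAt 𝓘(ℝ, V) u).symm y v,
        mfderiv 𝓘(ℝ, V) 𝓘(ℝ, V) (extChartAt 𝓘(ℝ, V) u).symm y w'] :=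
    congrArg (Ω ((extChartAt 𝓘(ℝ, V) u).symm y)) (by funext i; fin_cases i <;> rfl)
  exact h.symm.trans (hv w')

/-- In finite dimension, smoothness of an operator-valued map can be tested on constant vectors. -/
theorem Form.IsSmooth.contDiffAt_flat (hΩ : Ω.IsSmooth) (u : E) :
    ContDiffAt ℝ ∞ (fun y => flat (Ω.inChart u y)) (extChartAt 𝓘(ℝ, V) u u) := by
  refine ContDiffOn.contDiffAt (s := (extChartAt 𝓘(ℝ, V) u).target) ?_
    (extChartAt_target_nhds (mem_extChartAt_target u))
  refine contDiffOn_clm_apply.2 fun v => contDiffOn_clm_apply.2 fun w y hy => ?_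
  refine ContDiffAt.contDiffWithinAt ?_
  exact contDiffAt_continuousAlternatingMap_apply (X := fun i _ => (![v, w] : Fin 2 → V) i)
    ((hΩ u).contDiffAt (extChartAt_target_nhds hy)) fun i => contDiffAt_const

/-- In a chart `H_f` is the inverse of `flat` applied to `df`, and operator inversion is smooth. -/
theorem isSmoothVField_hamiltonian (hΩ : IsSymplectic Ω) {f : E → ℝ} (hf : IsSmoothFun V f) :
    IsSmoothVField (hamiltonian Ω f) := by
  intro u
  rw [isSmoothVFieldAt_iff]
  set φ := extChartAt 𝓘(ℝ, V) u with hφ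
  have hfc : ContDiffAt ℝ ∞ (fderiv ℝ (f ∘ φ.symm)) (φ u) :=
    (contMDiffAt_iff_chart.1 (hf u)).fderiv_right (by simp)
  have hinv := hΩ.isInvertible_flat_inChart (mem_extChartAt_target (I := 𝓘(ℝ, V)) u)
  have hs : ContDiffAt ℝ ∞ (fun y => (flat (Ω.inChart u y)).inverse (fderiv ℝ (f ∘ φ.symm) y))
      (φ u) :=
    (ContDiffAt.comp (φ u) (g := ContinuousLinearMap.inverse) hinv.contDiffAt_map_inverse
      (hΩ.smooth.contDiffAt_flat u)).clm_apply hfc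
  refine hs.congr_of_eventuallyEq ?_
  filter_upwards [extChartAt_target_nhds (mem_extChartAt_target u)] with y hy
  have hi := hΩ.isInvertible_flat_inChart hy
  refine hi.injective ?_
  rw [hi.self_apply_inverse]
  ext w
  have h := Ω.inChart_two (hamiltonian Ω f) (ofChart u fun _ => w) hy
  rw [hamiltonian_spec hΩ, mvfderiv_apply_chart _ hy ((hf _).mdifferentiableAt (by simp)),
    chartVField_ofChart _ hy] at h
  exact h

theorem isSmoothFun_poisson (hΩ : IsSymplectic Ω) {f g : E → ℝ} (hf : IsSmoothFun V f)
    (hg : IsSmoothFun V g) : IsSmoothFun V (poisson Ω f g) := fun u =>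
  contMDiffAt_mvfderiv_apply (hg u) (isSmoothVField_hamiltonian hΩ hf u)

theorem poisson_swap (hΩ : IsSymplectic Ω) (f g : E → ℝ) : poisson Ω f g = -poisson Ω g f := by
  funext u
  simp only [poisson, Pi.neg_apply]
  rw [← hamiltonian_spec hΩ, ← hamiltonian_spec hΩ, alternating_two_swap]

theorem poisson_add_right {f g h : E → ℝ} (hg : IsSmoothFun V g) (hh : IsSmoothFun V h) :
    poisson Ω f (g + h) = poisson Ω f g + poisson Ω f h := by
  funext u
  simp only [poisson, Pi.add_apply]
  rw [mvfderiv_add ((hg u).mdifferentiableAt (by simp)) ((hh u).mdifferentiableAt (by simp))]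
  rfl

theorem poisson_smul_right (c : ℝ) {f g : E → ℝ} (hg : IsSmoothFun V g) :
    poisson Ω f (c • g) = c • poisson Ω f g := by
  funext u
  have h := mvfderiv_smul (I := 𝓘(ℝ, V)) (a := fun _ : E => c) (x := u) mdifferentiableAt_const
    ((hg u).mdifferentiableAt (by simp))
  have e : c • g = (fun _ : E => c) • g := rfl
  simp only [poisson, Pi.smul_apply]
  rw [e, h, mvfderiv_const]
  simp

/-- `H_{f, g} = [H_f, H_g]`. -/
theorem hamiltonian_poisson (hΩ : IsSymplectic Ω) {f g : E → ℝ} (hf : IsSmoothFun V f)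
    (hg : IsSmoothFun V g) (u : E) :
    mlieBracket 𝓘(ℝ, V) (hamiltonian Ω f) (hamiltonian Ω g) u =
      hamiltonian Ω (poisson Ω f g) u := by
  refine hΩ.eq_hamiltonian fun w => ?_
  obtain ⟨Z, hZ, rfl⟩ := exists_isSmoothVFieldAt u w
  have hF := isSmoothVField_hamiltonian hΩ hf u
  have hG := isSmoothVField_hamiltonian hΩ hg u
  -- Expand `dΩ(H_f, H_g, Z) = 0`. Each `Ω`-term except `Ω([H_f, H_g], Z)` becomes an iterated
  -- derivative of `f` or `g`; all of these cancel except `Z(H_f g) = Z{f, g}`.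
  have h := hΩ.smooth.d_apply_two hF hG hZ
  have h0 : Ω.d u ![hamiltonian Ω f u, hamiltonian Ω g u, Z u] = 0 := by rw [hΩ.closed]; rfl
  have e1 : (fun z => Ω z ![hamiltonian Ω g z, Z z]) = fun z => mvfderiv 𝓘(ℝ, V) g z (Z z) :=
    funext fun z => hamiltonian_spec hΩ g z (Z z)
  have e2 : (fun z => Ω z ![hamiltonian Ω f z, Z z]) = fun z => mvfderiv 𝓘(ℝ, V) f z (Z z) :=
    funext fun z => hamiltonian_spec hΩ f z (Z z)
  have e3 : (fun z => Ω z ![hamiltonian Ω f z, hamiltonian Ω g z]) =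
      fun z => mvfderiv 𝓘(ℝ, V) f z (hamiltonian Ω g z) :=
    funext fun z => hamiltonian_spec hΩ f z (hamiltonian Ω g z)
  rw [e1, e2, e3] at h
  rw [h0, alternating_two_swap _ _ (hamiltonian Ω g u),
    alternating_two_swap _ _ (hamiltonian Ω f u),
    hamiltonian_spec hΩ, hamiltonian_spec hΩ, mvfderiv_mlieBracket (hg u) hF hZ,
    mvfderiv_mlieBracket (hf u) hG hZ] at h
  change _ = mvfderiv 𝓘(ℝ, V) (fun z => mvfderiv 𝓘(ℝ, V) g z (hamiltonian Ω f z)) u (Z u)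
  linarith

/-- This is the commutator formula for `[H_f, H_g]` acting on `h`, with the bracket replaced by
`H_{f, g}`. -/
theorem poisson_jacobi (hΩ : IsSymplectic Ω) {f g h : E → ℝ} (hf : IsSmoothFun V f)
    (hg : IsSmoothFun V g) (hh : IsSmoothFun V h) :
    poisson Ω f (poisson Ω g h) =
      poisson Ω (poisson Ω f g) h + poisson Ω g (poisson Ω f h) := by
  funext u
  have e := mvfderiv_mlieBracket (hh u) (isSmoothVField_hamiltonian hΩ hf u)
    (isSmoothVField_hamiltonian hΩ hg u)
  rw [hamiltonian_poisson hΩ hf hg] at e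
  rw [Pi.add_apply]
  exact (sub_eq_iff_eq_add.1 e.symm)

end Symplectic

/-! ### Liouville lifts and the momentum map. -/

section Liouville

variable {V : Type*} [NormedAddCommGroup V] [NormedSpace ℝ V] [FiniteDimensional ℝ V]
  {E : Type*} [TopologicalSpace E] [ChartedSpace V E] [IsManifold 𝓘(ℝ, V) ∞ E]
  {B : Type*} [NormedAddCommGroup B] [NormedSpace ℝ B] [FiniteDimensional ℝ B]
  {M : Type*} [TopologicalSpace M] [ChartedSpace B M] [IsManifold 𝓘(ℝ, B) ∞ M]
  {p : E → M} {Ω : Form V E 2} {Θ : Form V E 1}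

theorem Form.IsSmooth.contMDiffAt_one (hΘ : Θ.IsSmooth) {X : VField V E} {u : E}
    (hX : IsSmoothVFieldAt X u) :
    ContMDiffAt 𝓘(ℝ, V) 𝓘(ℝ, ℝ) ∞ (fun z => Θ z ![X z]) u := by
  have h := hΘ.contMDiffAt_apply (X := fun _ => X) fun _ => hX
  convert h using 4 with z
  rename_i i
  fin_cases i
  rfl

theorem lieDeriv_one (Z : VField V E) (Θ : Form V E 1) (Y : Fin 1 → VField V E) (u : E) :
    lieDeriv Z Θ Y u = mvfderiv 𝓘(ℝ, V) (fun z => Θ z ![Y 0 z]) u (Z u) -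
      Θ u ![mlieBracket 𝓘(ℝ, V) Z (Y 0) u] := by
  have e (z : E) : (fun i => Y i z) = ![Y 0 z] := by funext i; fin_cases i; rfl
  have e' (v : TangentSpace 𝓘(ℝ, V) u) : Function.update ![Y 0 u] 0 v = ![v] := by
    funext i; fin_cases i; rfl
  simp only [lieDeriv, e, Fin.sum_univ_one, e']

theorem momentum_eq (hΘ : IsLiouvilleForm B p Ω Θ) {X : VField B M} {u : E}
    {v : TangentSpace 𝓘(ℝ, V) u} (hv : mfderiv 𝓘(ℝ, V) 𝓘(ℝ, B) p u v = X (p u)) :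
    momentum p Θ X u = -Θ u ![v] :=
  congrArg Neg.neg (evalBase_eq hΘ X u v hv)

theorem momentum_eventuallyEq (hΘ : IsLiouvilleForm B p Ω Θ) {X : VField B M} {Z : VField V E}
    {u : E} (hZ : ∀ᶠ z in 𝓝 u, mfderiv 𝓘(ℝ, V) 𝓘(ℝ, B) p z (Z z) = X (p z)) :
    (fun z => Θ z ![Z z]) =ᶠ[𝓝 u] -momentum p Θ X := by
  filter_upwards [hZ] with z hz
  rw [Pi.neg_apply, momentum_eq hΘ hz, neg_neg]

/-- The preimages in `evalBase` are chosen pointwise; since the choice does not matter, a smooth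
local lift may replace them. -/
theorem isSmoothFun_momentum (hp : ContMDiff 𝓘(ℝ, V) 𝓘(ℝ, B) ∞ p)
    (hs : ∀ u, Function.Surjective (mfderiv 𝓘(ℝ, V) 𝓘(ℝ, B) p u))
    (hΘ : IsLiouvilleForm B p Ω Θ) {X : VField B M} (hX : IsSmoothVField X) :
    IsSmoothFun V (momentum p Θ X) := by
  intro u
  obtain ⟨v, hv⟩ := hs u (X (p u))
  obtain ⟨Z, hZ, -, hZX⟩ := exists_local_lift hp (hs u) (hX (p u)) v hv
  refine (hΘ.smooth.contMDiffAt_one hZ).neg.congr_of_eventuallyEq ?_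
  filter_upwards [momentum_eventuallyEq hΘ hZX] with z hz
  rw [hz, Pi.neg_apply, neg_neg]

/-- For local lifts `Z` of `X`, `L_Z Θ = i_Z Ω - d (-Θ(X ∘ p))`. -/
theorem lieDeriv_of_projects (hΘ : IsLiouvilleForm B p Ω Θ) {X : VField B M} {Z : VField V E}
    {u : E} (hZs : IsSmoothVFieldAt Z u)
    (hZ : ∀ᶠ z in 𝓝 u, mfderiv 𝓘(ℝ, V) 𝓘(ℝ, B) p z (Z z) = X (p z)) {Y : Fin 1 → VField V E}
    (hY : ∀ i, IsSmoothVFieldAt (Y i) u) :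
    lieDeriv Z Θ Y u = Ω u ![Z u, Y 0 u] - mvfderiv 𝓘(ℝ, V) (momentum p Θ X) u (Y 0 u) := by
  rw [lieDeriv_one, hΘ.d_eq, hΘ.smooth.d_apply_one hZs (hY 0),
    mvfderiv_congr (momentum_eventuallyEq hΘ hZ), mvfderiv_neg, neg_apply]
  ring

/-- This is where the Lagrangian condition enters: a vector `Ω`-orthogonal to the vertical space is
vertical. -/
theorem mfderiv_hamiltonian_momentum (hp : ContMDiff 𝓘(ℝ, V) 𝓘(ℝ, B) ∞ p)
    (hs : ∀ u, Function.Surjective (mfderiv 𝓘(ℝ, V) 𝓘(ℝ, B) p u)) (hΩ : IsSymplectic Ω)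
    (hΘ : IsLiouvilleForm B p Ω Θ) {X : VField B M} (hX : IsSmoothVField X) (u : E) :
    mfderiv 𝓘(ℝ, V) 𝓘(ℝ, B) p u (hamiltonian Ω (momentum p Θ X) u) = X (p u) := by
  obtain ⟨v, hv⟩ := hs u (X (p u))
  obtain ⟨Z, hZ, rfl, hZX⟩ := exists_local_lift hp (hs u) (hX (p u)) v hv
  have h0 : IsSmoothVFieldAt (0 : VField B M) (p u) :=
    isSmoothVFieldAt_iff.2 (by
      have : chartVField (p u) (0 : VField B M) = fun _ => 0 := by
        funext y
        exact map_zero _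
      rw [this]
      exact contDiffAt_const)
  have hv : Z u - hamiltonian Ω (momentum p Θ X) u ∈ vertical V B p u := by
    rw [hΘ.lagrangian]
    intro w hw
    -- A vertical vector extends to a local lift of the zero field, that is, to a local vertical
    -- field.
    obtain ⟨Y, hY, rfl, hY0⟩ := exists_local_lift hp (hs u) h0 w hw
    have hΘY : (fun z => Θ z ![Y z]) =ᶠ[𝓝 u] fun _ => 0 := by
      filter_upwards [hY0] with z hz
      exact hΘ.horizontal z _ hz
    have hb : mlieBracket 𝓘(ℝ, V) Z Y u ∈ vertical V B p u := by
      have h := mfderiv_mlieBracket hp hZ hY (hX (p u)) h0 hZX hY0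
      rw [mlieBracket_zero_right] at h
      exact h
    -- The left side vanishes because `Θ` kills both `Y` and `[Z, Y]`; what remains is `Ω(Z, Y) =
    -- d(momentum)(Y) = Ω(H, Y)`.
    have h1 := lieDeriv_of_projects hΘ hZ hZX (Y := ![Y]) (by intro i; fin_cases i; exact hY)
    rw [lieDeriv_one] at h1
    simp only [Matrix.cons_val_zero] at h1
    rw [mvfderiv_congr hΘY, mvfderiv_const, hΘ.horizontal u _ hb] at h1
    rw [alternating_two_sub, hamiltonian_spec hΩ, ← h1]
    simp
  have h := hv
  rw [vertical, LinearMap.mem_ker] at h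
  have h' := (map_sub (mfderiv 𝓘(ℝ, V) 𝓘(ℝ, B) p u) _ _).symm.trans h
  rw [← hZX.self_of_nhds]
  exact (sub_eq_zero.1 h').symm

theorem isLiouvilleLift_hamiltonian (hp : ContMDiff 𝓘(ℝ, V) 𝓘(ℝ, B) ∞ p)
    (hs : ∀ u, Function.Surjective (mfderiv 𝓘(ℝ, V) 𝓘(ℝ, B) p u)) (hΩ : IsSymplectic Ω)
    (hΘ : IsLiouvilleForm B p Ω Θ) {X : VField B M} (hX : IsSmoothVField X) :
    IsLiouvilleLift p Θ X (hamiltonian Ω (momentum p Θ X)) where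
  smooth := isSmoothVField_hamiltonian hΩ (isSmoothFun_momentum hp hs hΘ hX)
  projects := mfderiv_hamiltonian_momentum hp hs hΩ hΘ hX
  preserves u Y hY := by
    rw [lieDeriv_of_projects hΘ
      (isSmoothVField_hamiltonian hΩ (isSmoothFun_momentum hp hs hΘ hX) u)
      (Eventually.of_forall (mfderiv_hamiltonian_momentum hp hs hΩ hΘ hX)) hY,
      hamiltonian_spec hΩ, sub_self]

theorem IsLiouvilleLift.apply_eq (hΘ : IsLiouvilleForm B p Ω Θ) {X : VField B M} {Z : VField V E}
    (hZ : IsLiouvilleLift p Θ X Z) (u : E) (w : TangentSpace 𝓘(ℝ, V) u) :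
    Ω u ![Z u, w] = mvfderiv 𝓘(ℝ, V) (momentum p Θ X) u w := by
  obtain ⟨Y, hY, rfl⟩ := exists_isSmoothVFieldAt u w
  have h := lieDeriv_of_projects hΘ (hZ.smooth u) (Eventually.of_forall hZ.projects)
    (Y := ![Y]) (by intro i; fin_cases i; exact hY)
  rw [hZ.preserves u ![Y] (by intro i; fin_cases i; exact hY)] at h
  exact (sub_eq_zero.1 h.symm)

theorem momentum_add (hs : ∀ u, Function.Surjective (mfderiv 𝓘(ℝ, V) 𝓘(ℝ, B) p u))
    (hΘ : IsLiouvilleForm B p Ω Θ) (X Y : VField B M) :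
    momentum p Θ (X + Y) = momentum p Θ X + momentum p Θ Y := by
  funext u
  obtain ⟨v, hv⟩ := hs u (X (p u))
  obtain ⟨w, hw⟩ := hs u (Y (p u))
  rw [Pi.add_apply, momentum_eq hΘ hv, momentum_eq hΘ hw,
    momentum_eq hΘ (v := v + w) (by rw [map_add, hv, hw]; rfl), (Θ u).vecCons_add, neg_add]

theorem momentum_smul (hs : ∀ u, Function.Surjective (mfderiv 𝓘(ℝ, V) 𝓘(ℝ, B) p u))
    (hΘ : IsLiouvilleForm B p Ω Θ) (c : ℝ) (X : VField B M) :
    momentum p Θ (c • X) = c • momentum p Θ X := by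
  funext u
  obtain ⟨v, hv⟩ := hs u (X (p u))
  rw [Pi.smul_apply, momentum_eq hΘ hv,
    momentum_eq hΘ (v := c • v) (by rw [map_smul, hv]; rfl), (Θ u).vecCons_smul, smul_neg]

/-- With `H_X` and `H_Y` the lifts, `[H_X, H_Y]` lifts `[X, Y]`, and `L_{H_X} Θ = 0` gives `Θ([H_X,
H_Y]) = H_X(Θ(H_Y))`, which is minus the Poisson bracket of the momenta. -/
theorem momentum_mlieBracket (hp : ContMDiff 𝓘(ℝ, V) 𝓘(ℝ, B) ∞ p)
    (hs : ∀ u, Function.Surjective (mfderiv 𝓘(ℝ, V) 𝓘(ℝ, B) p u)) (hΩ : IsSymplectic Ω)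
    (hΘ : IsLiouvilleForm B p Ω Θ) {X Y : VField B M} (hX : IsSmoothVField X)
    (hY : IsSmoothVField Y) :
    momentum p Θ (mlieBracket 𝓘(ℝ, B) X Y) = poisson Ω (momentum p Θ X) (momentum p Θ Y) := by
  funext u
  have lX := isLiouvilleLift_hamiltonian hp hs hΩ hΘ hX
  have lY := isLiouvilleLift_hamiltonian hp hs hΩ hΘ hY
  have h := mfderiv_mlieBracket hp (lX.smooth u) (lY.smooth u) (hX (p u)) (hY (p u))
    (Eventually.of_forall lX.projects) (Eventually.of_forall lY.projects)
  rw [momentum_eq hΘ h]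
  have h1 := lX.preserves u ![hamiltonian Ω (momentum p Θ Y)]
    (by intro i; fin_cases i; exact lY.smooth u)
  rw [lieDeriv_one] at h1
  simp only [Matrix.cons_val_zero] at h1
  rw [mvfderiv_congr (momentum_eventuallyEq hΘ (Eventually.of_forall lY.projects)),
    mvfderiv_neg, neg_apply] at h1
  rw [← sub_eq_zero.1 h1, neg_neg]
  rfl

/-- The momentum determines its Hamiltonian field, which projects back onto `X`; surjectivity of `p`
reaches every point of `M`. -/
theorem momentum_injOn (hp : ContMDiff 𝓘(ℝ, V) 𝓘(ℝ, B) ∞ p) (hsurj : Function.Surjective p)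
    (hs : ∀ u, Function.Surjective (mfderiv 𝓘(ℝ, V) 𝓘(ℝ, B) p u)) (hΩ : IsSymplectic Ω)
    (hΘ : IsLiouvilleForm B p Ω Θ) :
    Set.InjOn (momentum p Θ) {X : VField B M | IsSmoothVField X} := by
  intro X hX Y hY h
  funext x
  obtain ⟨u, rfl⟩ := hsurj x
  rw [← mfderiv_hamiltonian_momentum hp hs hΩ hΘ hX, ← mfderiv_hamiltonian_momentum hp hs hΩ hΘ hY,
    h]

end Liouville

end LiouvilleLift

open LiouvilleLift in
theorem mainTheorem11
    {V : Type*} [NormedAddCommGroup V] [NormedSpace ℝ V] [FiniteDimensional ℝ V]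
    {B : Type*} [NormedAddCommGroup B] [NormedSpace ℝ B] [FiniteDimensional ℝ B]
    {W : Type*} [NormedAddCommGroup W] [NormedSpace ℝ W] [FiniteDimensional ℝ W]
    {E : Type*} [TopologicalSpace E] [ChartedSpace V E] [IsManifold 𝓘(ℝ, V) ∞ E]
    {M : Type*} [TopologicalSpace M] [ChartedSpace B M] [IsManifold 𝓘(ℝ, B) ∞ M]
    {F : Type*} [TopologicalSpace F] [ChartedSpace W F] [IsManifold 𝓘(ℝ, W) ∞ F] [Nonempty F]
    (p : E → M) (hp : IsSmoothFiberBundle V B W F p)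
    (Ω : Form V E 2) (hΩ : IsSymplectic Ω)
    (Θ : Form V E 1) (hΘ : IsLiouvilleForm B p Ω Θ) :
    -- the Liouville lift exists, is unique, and is the Hamiltonian vector field of `-Θ(X ∘ p)`
    (∀ X : VField B M, IsSmoothVField X →
      IsSmoothFun V (momentum p Θ X) ∧
      IsLiouvilleLift p Θ X (hamiltonian Ω (momentum p Θ X)) ∧
      ∀ Z : VField V E, IsLiouvilleLift p Θ X Z →
        (∀ (u : E) (w : TangentSpace 𝓘(ℝ, V) u),
          Ω u ![Z u, w] = mvfderiv 𝓘(ℝ, V) (momentum p Θ X) u w) ∧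
        Z = hamiltonian Ω (momentum p Θ X)) ∧
    -- the smooth functions on `E` form a Lie algebra under the Poisson bracket
    ((∀ f g : E → ℝ, IsSmoothFun V f → IsSmoothFun V g → IsSmoothFun V (poisson Ω f g)) ∧
      (∀ f g h : E → ℝ, IsSmoothFun V f → IsSmoothFun V g → IsSmoothFun V h →
        poisson Ω (f + g) h = poisson Ω f h + poisson Ω g h) ∧
      (∀ (c : ℝ) (f g : E → ℝ), IsSmoothFun V f → IsSmoothFun V g →
        poisson Ω (c • f) g = c • poisson Ω f g) ∧
      (∀ f g : E → ℝ, IsSmoothFun V f → IsSmoothFun V g →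
        poisson Ω f g = - poisson Ω g f) ∧
      (∀ f g h : E → ℝ, IsSmoothFun V f → IsSmoothFun V g → IsSmoothFun V h →
        poisson Ω f (poisson Ω g h) =
          poisson Ω (poisson Ω f g) h + poisson Ω g (poisson Ω f h))) ∧
    -- `X ↦ -Θ(X)` is linear, preserves brackets, and is injective
    ((∀ X Y : VField B M, IsSmoothVField X → IsSmoothVField Y →
        momentum p Θ (X + Y) = momentum p Θ X + momentum p Θ Y) ∧
      (∀ (c : ℝ) (X : VField B M), IsSmoothVField X →
        momentum p Θ (c • X) = c • momentum p Θ X) ∧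
      (∀ X Y : VField B M, IsSmoothVField X → IsSmoothVField Y →
        momentum p Θ (VectorField.mlieBracket 𝓘(ℝ, B) X Y) =
          poisson Ω (momentum p Θ X) (momentum p Θ Y)) ∧
      Set.InjOn (momentum p Θ) {X : VField B M | IsSmoothVField X}) := by
  have hs := hp.mfderiv_surjective
  refine ⟨fun X hX => ⟨isSmoothFun_momentum hp.smooth hs hΘ hX,
      isLiouvilleLift_hamiltonian hp.smooth hs hΩ hΘ hX, fun Z hZ =>
      ⟨hZ.apply_eq hΘ, funext fun u => hΩ.eq_hamiltonian (hZ.apply_eq hΘ u)⟩⟩,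
    ⟨fun f g hf hg => isSmoothFun_poisson hΩ hf hg, fun f g h hf hg hh => ?_,
      fun c f g hf hg => ?_, fun f g hf hg => poisson_swap hΩ f g,
      fun f g h hf hg hh => poisson_jacobi hΩ hf hg hh⟩,
    ⟨fun X Y _ _ => momentum_add hs hΘ X Y, fun c X _ => momentum_smul hs hΘ c X,
      fun X Y hX hY => momentum_mlieBracket hp.smooth hs hΩ hΘ hX hY,
      momentum_injOn hp.smooth hp.surjective hs hΩ hΘ⟩⟩
  -- Linearity in the first slot follows from linearity in the second by antisymmetry.
  · rw [poisson_swap hΩ, poisson_add_right hf hg, neg_add, ← poisson_swap hΩ, ← poisson_swap hΩ]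
  · rw [poisson_swap hΩ, poisson_smul_right c hf, ← smul_neg, ← poisson_swap hΩ]
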